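/- Let $k$ be a field, let $n\ge 0$ and $d\ge 1$ be integers, and let $S=k[x_0,\dots,x_n]$ with its standard grading ($S_m=0$ for $m<0$). Let $f_0,\dots,f_n\in S_d$ have no common zeros on $\mathbb{P}^n$ (that is, no common zeros in $\mathbb{P}^n(\bar k)$, where $\bar k$ is an algebraic closure of $k$). Put $I=\langle f_0,\dots,f_n\rangle$, $R=S/I$ with the induced grading, and $\rho=(n+1)(d-1)$. For $f\in S$ and $0\le j\le n$ let $\Delta_j(f)\in k[x_0,\dots,x_n,y_0,\dots,y_n]$ be the polynomial $$\Delta_j(f)=\frac{f(y_0,\dots,y_{j-1},x_j,x_{j+1},\dots,x_n)-f(y_0,\dots,y_{j-1},y_j,x_{j+1},\dots,x_n)}{x_j-y_j},$$ let $\Delta=\det(\Delta_j(f_i))_{0\le i,j\le n}$ be the Bezoutian of $f_0,\dots,f_n$, and write $\Delta=\sum_\alpha \Delta_\alpha(x)\,y^\alpha$ with $\Delta_\alpha\in S$. Then for every integer $a$ one has $\Delta_\alpha\in S_{\rho-a}$ whenever $|\alpha|=a$, and the map $$R_{\rho-a}^*\longrightarrow R_a,\qquad \varphi\longmapsto\sum_{|\alpha|=a}\varphi([\Delta_\alpha])\,[x^\alpha],$$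 is a well-defined isomorphism of $k$-vector spaces, where $R_{\rho-a}^*=\mathrm{Hom}_k(R_{\rho-a},k)$ and $[g]\in R$ denotes the coset of $g\in S$. -/

import Mathlib

namespace BezoutDuality

open MvPolynomial

/-- `S = k[x_0, …, x_n]`. -/
abbrev Poly (k : Type*) [Field k] (n : ℕ) : Type _ :=
  MvPolynomial (Fin (n + 1)) k

/-- `k[x_0, …, x_n, y_0, …, y_n]`, written as polynomials in the `y_i` with coefficients
in `k[x_0, …, x_n]`. The variable `x_i` is `C (X i)`, the variable `y_i` is `X i`. -/
abbrev DoublePoly (k : Type*) [Field k] (n : ℕ) : Type _ :=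
  MvPolynomial (Fin (n + 1)) (Poly k n)

section Bezoutian

variable {k : Type*} [Field k] {n : ℕ}

/-- The variable `x_i` of `k[x, y]`. -/
noncomputable def xVar (k : Type*) [Field k] {n : ℕ} (i : Fin (n + 1)) : DoublePoly k n :=
  C (X i)

/-- The variable `y_i` of `k[x, y]`. -/
noncomputable def yVar (k : Type*) [Field k] {n : ℕ} (i : Fin (n + 1)) : DoublePoly k n :=
  X i

/-- `f(y_0, …, y_{m-1}, x_m, …, x_n)`: the first `m` variables are replaced by `y`'s, the
others by `x`'s. -/
noncomputable def mixed (m : ℕ) (f : Poly k n) : DoublePoly k n :=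
  aeval (fun i : Fin (n + 1) => if (i : ℕ) < m then yVar k i else xVar k i) f

/-- `x_j - y_j` divides
`f(y_0, …, y_{j-1}, x_j, x_{j+1}, …, x_n) - f(y_0, …, y_{j-1}, y_j, x_{j+1}, …, x_n)`. -/
theorem sub_dvd_mixed_sub (j : Fin (n + 1)) (f : Poly k n) :
    xVar k j - yVar k j ∣ mixed (j : ℕ) f - mixed ((j : ℕ) + 1) f := by
  rw [← Ideal.mem_span_singleton, ← Ideal.Quotient.eq]
  set I : Ideal (DoublePoly k n) := Ideal.span {xVar k j - yVar k j}
  have h : (Ideal.Quotient.mkₐ k I).comp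
        (aeval (fun i : Fin (n + 1) => if (i : ℕ) < (j : ℕ) then yVar k i else xVar k i)) =
      (Ideal.Quotient.mkₐ k I).comp
        (aeval (fun i : Fin (n + 1) => if (i : ℕ) < (j : ℕ) + 1 then yVar k i else xVar k i)) := by
    apply MvPolynomial.algHom_ext
    intro i
    simp only [AlgHom.comp_apply, aeval_X, Ideal.Quotient.mkₐ_eq_mk]
    rcases lt_trichotomy (i : ℕ) (j : ℕ) with hij | hij | hij
    · rw [if_pos hij, if_pos (by omega)]
    · obtain rfl := Fin.ext hij
      rw [if_neg (by omega), if_pos (by omega)]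
      exact Ideal.Quotient.eq.2 (Ideal.subset_span rfl)
    · rw [if_neg (by omega), if_neg (by omega)]
  exact DFunLike.congr_fun h f

/-- The divided difference `Δ_j(f)`, the quotient of
`f(y_0, …, y_{j-1}, x_j, x_{j+1}, …, x_n) - f(y_0, …, y_{j-1}, y_j, x_{j+1}, …, x_n)`
by `x_j - y_j`. -/
noncomputable def dividedDiff (j : Fin (n + 1)) (f : Poly k n) : DoublePoly k n :=
  (sub_dvd_mixed_sub j f).choose

theorem mul_dividedDiff (j : Fin (n + 1)) (f : Poly k n) :
    (xVar k j - yVar k j) * dividedDiff j f = mixed (j : ℕ) f - mixed ((j : ℕ) + 1) f :=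
  (sub_dvd_mixed_sub j f).choose_spec.symm

/-- The Bezoutian `Δ = det (Δ_j(f_i))` of `f_0, …, f_n`. -/
noncomputable def bezoutian (f : Fin (n + 1) → Poly k n) : DoublePoly k n :=
  Matrix.det (Matrix.of fun i j : Fin (n + 1) => dividedDiff j (f i))

/-- `Δ_α(x)`, the coefficient of `y^α` in the Bezoutian. -/
noncomputable def bezoutCoeff (f : Fin (n + 1) → Poly k n) (α : Fin (n + 1) →₀ ℕ) : Poly k n :=
  coeff α (bezoutian f)

end Bezoutian

/-- The graded piece `S_m` of `S = k[x_0, …, x_n]`, for an integer `m`; it is zero for `m < 0`. -/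
noncomputable def polyPiece (k : Type*) [Field k] (n : ℕ) : ℤ → Submodule k (Poly k n)
  | Int.ofNat m => homogeneousSubmodule (Fin (n + 1)) k m
  | Int.negSucc _ => ⊥

/-- The graded piece `R_m` of `R = S / I`, i.e. the image of `S_m`. -/
noncomputable def quotPiece {k : Type*} [Field k] {n : ℕ} (I : Ideal (Poly k n)) (m : ℤ) :
    Submodule k (Poly k n ⧸ I) :=
  (polyPiece k n m).map (Ideal.Quotient.mkₐ k I).toLinearMap

theorem mk_mem_quotPiece {k : Type*} [Field k] {n : ℕ} (I : Ideal (Poly k n)) {m : ℤ}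
    {p : Poly k n} (hp : p ∈ polyPiece k n m) : Ideal.Quotient.mk I p ∈ quotPiece I m :=
  Submodule.mem_map_of_mem hp

/-- The finite set of exponents `α ∈ ℕ^{n+1}` with `|α| = a`, for an integer `a`. -/
def exponents (n : ℕ) : ℤ → Finset (Fin (n + 1) →₀ ℕ)
  | Int.ofNat a => Finset.finsuppAntidiag Finset.univ a
  | Int.negSucc _ => ∅

theorem mem_exponents {n : ℕ} {a : ℤ} {α : Fin (n + 1) →₀ ℕ} :
    α ∈ exponents n a ↔ (α.degree : ℤ) = a := by
  cases a with
  | ofNat a =>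
    simp only [exponents, Finset.mem_finsuppAntidiag, Finset.subset_univ, and_true,
      Finsupp.degree_eq_sum, Int.ofNat_eq_natCast, Nat.cast_inj]
  | negSucc a =>
    simp only [exponents, Finset.notMem_empty, false_iff]
    omega

/-- The homogeneous polynomials `f_0, …, f_n` have no common zeros on `ℙ^n`, i.e. no common zeros
with coordinates in an algebraic closure of `k` other than the origin. -/
def NoCommonZeros {k : Type*} [Field k] {n : ℕ} (f : Fin (n + 1) → Poly k n) : Prop :=
  ∀ v : Fin (n + 1) → AlgebraicClosure k, v ≠ 0 → ∃ i, aeval v (f i) ≠ 0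

end BezoutDuality

/-! Write `I` for the ideal of the `f_i`. By Cramer's rule `(x_j - y_j) Δ` lies in the ideal of the
`f_i(x) - f_i(y)`. Hence a functional `l` vanishing on `I`, applied to the coefficients in `x`,
satisfies `l(p(x) Δ) ≡ p(y) l(Δ)` modulo `I` in the `y` variables (`mapCoeff_C_mul_sub_mem`). Since
`Δ_0` is not in `I` (`bezoutCoeff_zero_notMem`), some `l` concentrated in degree `ρ` has `l(Δ_0) =
1`. As `Δ_α` has degree `ρ - |α|`, this forces `l(Δ) = 1`, so `p ≡ ∑ l(p Δ_α) x^α`: every `p` in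
degree `a` is the image of `q ↦ l(p q)`. Surjectivity in degrees `a` and `ρ - a` makes the finite
dimensions equal, hence bijectivity. -/

namespace BezoutDuality

open MvPolynomial

/-! ### Ideals generated by powers of variables -/

section PowerIdeal

variable {σ R : Type*} [CommRing R]

theorem mem_span_X_pow_iff {N : ℕ} {s : Set σ} {p : MvPolynomial σ R} :
    p ∈ Ideal.span ((fun j => (X j : MvPolynomial σ R) ^ N) '' s) ↔
      ∀ m ∈ p.support, ∃ j ∈ s, N ≤ m j := by
  have h : (fun j => (X j : MvPolynomial σ R) ^ N) '' s =
      (fun t => monomial t (1 : R)) '' ((fun j => Finsupp.single j N) '' s) := by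
    simp [Set.image_image, X_pow_eq_monomial]
  rw [h, mem_ideal_span_monomial_image]
  simp

/-- `x_i` is a nonzerodivisor modulo powers of the other variables. -/
theorem mem_span_X_pow_of_X_mul_mem {N : ℕ} {s : Set σ} {i : σ} (hi : i ∉ s)
    {p : MvPolynomial σ R}
    (h : X i * p ∈ Ideal.span ((fun j => (X j : MvPolynomial σ R) ^ N) '' s)) :
    p ∈ Ideal.span ((fun j => (X j : MvPolynomial σ R) ^ N) '' s) := by
  classical
  rw [mem_span_X_pow_iff] at h ⊢
  intro m hm
  obtain ⟨j, hj, hN⟩ := h (Finsupp.single i 1 + m) (by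
    rw [mem_support_iff, coeff_X_mul]
    exact mem_support_iff.1 hm)
  refine ⟨j, hj, ?_⟩
  have hij : i ≠ j := fun h => hi (h ▸ hj)
  simpa [Finsupp.single_apply, hij] using hN

end PowerIdeal

/-! ### Determinant identities -/

section Cramer

variable {ι A : Type*} [Fintype ι] [DecidableEq ι] [CommRing A]

theorem det_mul_mem_of_mulVec_mem {M : Matrix ι ι A} {v : ι → A} {J : Ideal A}
    (h : ∀ i, (M.mulVec v) i ∈ J) (j : ι) : M.det * v j ∈ J := by
  have h1 : (M.adjugate.mulVec (M.mulVec v)) j = M.det * v j := by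
    rw [Matrix.mulVec_mulVec, Matrix.adjugate_mul, Matrix.smul_mulVec, Matrix.one_mulVec]
    rfl
  rw [← h1]
  exact J.sum_mem fun i _ => J.mul_mem_left _ (h i)

theorem det_updateRow_sub (M : Matrix ι ι A) (i : ι) (u v : ι → A) :
    (M.updateRow i (u - v)).det = (M.updateRow i u).det - (M.updateRow i v).det := by
  rw [eq_sub_iff_add_eq, ← Matrix.det_updateRow_add, sub_add_cancel]

end Cramer

/-! ### The determinant of `G` in `f = G x` is not in the ideal of `f` -/

section Nonvanishing

variable {ι R : Type*} [Fintype ι] [DecidableEq ι] [CommRing R]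

/-- The rows of `M` can be exchanged one at a time for those of the diagonal matrix of the `X i ^
N`, because both have the same product with the vector `X`. -/
theorem det_updateRows_sub_det_mem {N : ℕ} {M : Matrix ι ι (MvPolynomial ι R)}
    (hM : M.mulVec X = fun i => X i ^ (N + 1)) (s : Finset ι) :
    (Matrix.of fun i => if i ∈ s then Pi.single i (X i ^ N) else M i).det - M.det ∈
      Ideal.span (Set.range fun j => (X j : MvPolynomial ι R) ^ (N + 1)) := by
  induction s using Finset.induction_on with
  | empty =>
    have : (Matrix.of fun i => if i ∈ (∅ : Finset ι) then Pi.single i (X i ^ N) else M i) = M := by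
      ext1 i; simp
    rw [this, sub_self]
    exact Submodule.zero_mem _
  | insert a s ha ih =>
    set B : Matrix ι ι (MvPolynomial ι R) :=
      Matrix.of fun i => if i ∈ s then Pi.single i (X i ^ N) else M i with hB
    have hrow : ∀ i, B i ⬝ᵥ X = X i ^ (N + 1) := by
      intro i
      by_cases hi : i ∈ s
      · have : B i = Pi.single i (X i ^ N) := if_pos hi
        simp [this, pow_succ]
      · have : B i = M i := if_neg hi
        rw [this]
        exact congrFun hM i
    have hins : (Matrix.of fun i => if i ∈ insert a s then Pi.single i (X i ^ N) else M i) =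
        B.updateRow a (Pi.single a (X a ^ N)) := by
      ext1 i
      by_cases hi : i = a
      · subst hi; simp
      · simp [hB, hi]
    have hdiff : (B.updateRow a (Pi.single a (X a ^ N))).det - B.det =
        (B.updateRow a (Pi.single a (X a ^ N) - B a)).det := by
      rw [det_updateRow_sub, Matrix.updateRow_eq_self]
    rw [hins, ← sub_add_sub_cancel _ B.det, hdiff]
    refine Ideal.add_mem _ ?_ ih
    have hmem : (B.updateRow a (Pi.single a (X a ^ N) - B a)).det ∈
        Ideal.span ((fun j => (X j : MvPolynomial ι R) ^ (N + 1)) '' {a}ᶜ) := by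
      -- Row `a` now kills the vector `X`, so Cramer's rule puts `X a` times the determinant in the
      -- ideal of the other powers, and `X a` can be cancelled there.
      apply mem_span_X_pow_of_X_mul_mem (i := a) (by simp)
      rw [mul_comm]
      apply det_mul_mem_of_mulVec_mem
      intro i
      rw [Matrix.mulVec]
      by_cases hi : i = a
      · subst hi
        rw [Matrix.updateRow_self, sub_dotProduct, hrow]
        simp [pow_succ]
      · rw [Matrix.updateRow_ne hi, hrow]
        exact Ideal.subset_span ⟨i, hi, rfl⟩
    exact Ideal.span_mono (Set.image_subset_range _ _) hmem

/-- Modulo the ideal the determinant is `∏ X i ^ N`, a monomial divisible by no `X i ^ (N + 1)`. -/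
theorem det_notMem_span_X_pow [Nontrivial R] {N : ℕ} {M : Matrix ι ι (MvPolynomial ι R)}
    (hM : M.mulVec X = fun i => X i ^ (N + 1)) :
    M.det ∉ Ideal.span (Set.range fun j => (X j : MvPolynomial ι R) ^ (N + 1)) := by
  intro h
  have h1 := det_updateRows_sub_det_mem hM Finset.univ
  have h2 : (Matrix.of fun i => if i ∈ (Finset.univ : Finset ι) then
      (Pi.single i (X i ^ N) : ι → MvPolynomial ι R) else M i) =
      Matrix.diagonal fun i => X i ^ N := by
    ext1 i j
    simp [Matrix.diagonal_apply, Pi.single_apply, eq_comm]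
  rw [h2, Matrix.det_diagonal] at h1
  have h3 := Ideal.add_mem _ h1 h
  rw [sub_add_cancel] at h3
  rw [← Set.image_univ, mem_span_X_pow_iff] at h3
  have h4 : (∏ i, (X i : MvPolynomial ι R) ^ N) =
      monomial (Finsupp.equivFunOnFinite.symm fun _ => N) 1 := by
    rw [monomial_eq, Finsupp.prod_fintype _ _ (by simp)]
    simp
  rw [h4] at h3
  obtain ⟨j, -, hj⟩ := h3 (Finsupp.equivFunOnFinite.symm fun _ => N) (by simp)
  simp at hj

/-- If `f = G x` and the ideal of `f` contains powers of all variables, then `det G` is not in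
the ideal of `f`. -/
theorem det_notMem_span_of_X_pow_mem [Nontrivial R] {N : ℕ} {f : ι → MvPolynomial ι R}
    {G : Matrix ι ι (MvPolynomial ι R)} (hG : G.mulVec X = f)
    (hN : ∀ i, X i ^ (N + 1) ∈ Ideal.span (Set.range f)) :
    G.det ∉ Ideal.span (Set.range f) := by
  intro hdet
  choose H hH using fun i => Ideal.mem_span_range_iff_exists_fun.1 (hN i)
  have hHf : (Matrix.of H).mulVec f = fun i => X i ^ (N + 1) := by
    ext1 i
    rw [← hH i]
    rfl
  apply det_notMem_span_X_pow (M := Matrix.of H * G) (N := N)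
    (by rw [← Matrix.mulVec_mulVec, hG, hHf])
  -- If `det G = ∑ c j * f j`, each `det H * f j` lies in the ideal of powers by Cramer's rule for
  -- `H`, hence so does `det (H * G)`.
  rw [Matrix.det_mul]
  obtain ⟨c, hc⟩ := Ideal.mem_span_range_iff_exists_fun.1 hdet
  rw [← hc, Finset.mul_sum]
  refine Ideal.sum_mem _ fun j _ => ?_
  rw [mul_left_comm]
  refine Ideal.mul_mem_left _ _ (det_mul_mem_of_mulVec_mem (fun i => ?_) j)
  rw [hHf]
  exact Ideal.subset_span ⟨i, rfl⟩

end Nonvanishing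

/-! ### Powers of the variables in the ideal -/

section Nullstellensatz

variable {k : Type*} [Field k] {n : ℕ}

theorem exists_X_pow_mem {f : Fin (n + 1) → Poly k n} (hf0 : NoCommonZeros f) :
    ∃ N : ℕ, ∀ i, (X i : Poly k n) ^ (N + 1) ∈ Ideal.span (Set.range f) := by
  have h : ∀ i, ∃ N : ℕ, (X i : Poly k n) ^ N ∈ Ideal.span (Set.range f) := by
    intro i
    change X i ∈ (Ideal.span (Set.range f)).radical
    rw [← vanishingIdeal_zeroLocus_eq_radical (K := AlgebraicClosure k), zeroLocus_span]
    intro v hv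
    have hv0 : v = 0 := by
      by_contra hne
      obtain ⟨j, hj⟩ := hf0 v hne
      exact hj (hv _ ⟨j, rfl⟩)
    simp [hv0]
  choose N hN using h
  refine ⟨∑ i, N i, fun i => Ideal.pow_mem_of_pow_mem _ (hN i) ?_⟩
  exact (Finset.single_le_sum (fun _ _ => Nat.zero_le _) (Finset.mem_univ i)).trans
    (Nat.le_succ _)

end Nullstellensatz

/-! ### Degrees of the Bezoutian and its coefficients -/

section TotalDegree

variable {k : Type*} [Field k] {n : ℕ}

/-- The polynomials in `k[x, y]` that are homogeneous of degree `m` in all the variables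
`x_i`, `y_i` together. -/
def totalPiece (k : Type*) [Field k] (n m : ℕ) : Submodule k (DoublePoly k n) where
  carrier := {p | ∀ α β, coeff β (coeff α p) ≠ 0 → α.degree + β.degree = m}
  zero_mem' := by simp
  add_mem' {p q} hp hq α β h := by
    by_cases h1 : coeff β (coeff α p) = 0
    · refine hq α β fun h2 => h ?_
      rw [coeff_add, coeff_add, h1, h2, add_zero]
    · exact hp α β h1
  smul_mem' c p hp α β h := by
    refine hp α β fun h1 => h ?_
    rw [coeff_smul, coeff_smul, h1, smul_zero]

instance totalPiece_gradedMonoid : SetLike.GradedMonoid (totalPiece k n) where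
  one_mem α β h := by
    classical
    rw [coeff_one] at h
    split_ifs at h with hα
    · rw [coeff_one] at h
      split_ifs at h with hβ
      · simp [← hα, ← hβ]
      · exact absurd rfl h
    · simp at h
  mul_mem i j p q hp hq α β h := by
    classical
    rw [coeff_mul, coeff_sum] at h
    obtain ⟨⟨α₁, α₂⟩, hα, h⟩ := Finset.exists_ne_zero_of_sum_ne_zero h
    rw [coeff_mul] at h
    obtain ⟨⟨β₁, β₂⟩, hβ, h⟩ := Finset.exists_ne_zero_of_sum_ne_zero h
    have h1 := hp _ _ (left_ne_zero_of_mul h)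
    have h2 := hq _ _ (right_ne_zero_of_mul h)
    rw [Finset.HasAntidiagonal.mem_antidiagonal] at hα hβ
    simp only at h1 h2 hα hβ
    rw [← hα, ← hβ, map_add, map_add]
    omega

theorem xVar_mem_totalPiece (i : Fin (n + 1)) : xVar k i ∈ totalPiece k n 1 := by
  classical
  intro α β h
  rw [xVar, coeff_C] at h
  split_ifs at h with hα
  · rw [coeff_X] at h
    split_ifs at h with hβ
    · simp [← hα, ← hβ]
    · exact absurd rfl h
  · simp at h

theorem yVar_mem_totalPiece (i : Fin (n + 1)) : yVar k i ∈ totalPiece k n 1 := by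
  classical
  intro α β h
  rw [yVar, coeff_X] at h
  split_ifs at h with hα
  · rw [coeff_one] at h
    split_ifs at h with hβ
    · simp [← hα, ← hβ]
    · exact absurd rfl h
  · simp at h

theorem aeval_mem_totalPiece {d : ℕ} {f : Poly k n} (hf : f.IsHomogeneous d)
    {g : Fin (n + 1) → DoublePoly k n} (hg : ∀ i, g i ∈ totalPiece k n 1) :
    aeval g f ∈ totalPiece k n d := by
  rw [aeval_def, eval₂_eq']
  refine Submodule.sum_mem _ fun α hα => ?_
  rw [← Algebra.smul_def]
  refine Submodule.smul_mem _ _ ?_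
  have h := SetLike.prod_pow_mem_graded (totalPiece k n) (fun _ => 1) g (F := Finset.univ) α
    fun i _ => hg i
  have hd := hf.degree_eq_sum_deg_support hα
  rw [← Finsupp.degree_apply, Finsupp.degree_eq_sum] at hd
  convert h
  simpa using hd

theorem mixed_mem_totalPiece {d : ℕ} {f : Poly k n} (hf : f.IsHomogeneous d) (m : ℕ) :
    mixed m f ∈ totalPiece k n d := by
  refine aeval_mem_totalPiece hf fun i => ?_
  split_ifs
  · exact yVar_mem_totalPiece i
  · exact xVar_mem_totalPiece i

/-- A polynomial whose product with `x_j - y_j` is homogeneous is itself homogeneous. -/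
theorem mem_totalPiece_of_sub_mul_mem {m : ℕ} (j : Fin (n + 1)) {q : DoublePoly k n}
    (hq : (xVar k j - yVar k j) * q ∈ totalPiece k n (m + 1)) : q ∈ totalPiece k n m := by
  classical
  -- Induction on the exponent of `x_j`: either the product has a nonzero coefficient at `x^β y^(α +
  -- e_j)`, or the coefficient of `q` at `x^β y^α` equals the one at `x^(β - e_j) y^(α + e_j)`, of
  -- the same total degree.
  have key : ∀ b : ℕ, ∀ α β : Fin (n + 1) →₀ ℕ, β j = b → coeff β (coeff α q) ≠ 0 →
      α.degree + β.degree = m := by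
    intro b
    induction b with
    | zero =>
      intro α β hβ h
      have h1 := hq (Finsupp.single j 1 + α) β (by
        rw [sub_mul, coeff_sub, xVar, yVar, coeff_C_mul, coeff_X_mul, coeff_sub, coeff_X_mul',
          if_neg (by simpa using hβ), zero_sub]
        exact neg_ne_zero.2 h)
      rw [map_add, Finsupp.degree_single] at h1
      omega
    | succ b ih =>
      intro α β hβ h
      by_cases h0 : coeff β (coeff (Finsupp.single j 1 + α) ((xVar k j - yVar k j) * q)) = 0
      · have hle : Finsupp.single j 1 ≤ β := by
          rw [Finsupp.single_le_iff]
          omega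
        obtain ⟨γ, rfl⟩ := exists_add_of_le hle
        rw [sub_mul, coeff_sub, xVar, yVar, coeff_C_mul, coeff_X_mul, coeff_sub, coeff_X_mul,
          sub_eq_zero] at h0
        have h1 := ih (Finsupp.single j 1 + α) γ (by
          rw [Finsupp.add_apply, Finsupp.single_eq_same] at hβ
          omega) (by rwa [h0])
        rw [map_add, Finsupp.degree_single] at h1 ⊢
        omega
      · have h1 := hq _ _ h0
        rw [map_add, Finsupp.degree_single] at h1
        omega
  exact fun α β => key _ α β rfl

theorem dividedDiff_mem_totalPiece {d : ℕ} {f : Poly k n} (hf : f.IsHomogeneous (d + 1))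
    (j : Fin (n + 1)) : dividedDiff j f ∈ totalPiece k n d := by
  apply mem_totalPiece_of_sub_mul_mem j
  rw [mul_dividedDiff]
  exact Submodule.sub_mem _ (mixed_mem_totalPiece hf _) (mixed_mem_totalPiece hf _)

theorem bezoutian_mem_totalPiece {d : ℕ} {f : Fin (n + 1) → Poly k n}
    (hf : ∀ i, (f i).IsHomogeneous (d + 1)) :
    bezoutian f ∈ totalPiece k n ((n + 1) * d) := by
  rw [bezoutian, Matrix.det_apply]
  refine Submodule.sum_mem _ fun σ _ => ?_
  have h := SetLike.prod_mem_graded (totalPiece k n) (fun _ => d)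
    (fun i => Matrix.of (fun i j => dividedDiff j (f i)) (σ i) i) (F := Finset.univ)
    fun i _ => dividedDiff_mem_totalPiece (hf (σ i)) i
  rw [Finset.sum_const, Finset.card_univ, Fintype.card_fin, smul_eq_mul] at h
  rcases Int.units_eq_one_or (Equiv.Perm.sign σ) with hσ | hσ
  · rwa [hσ, one_smul]
  · rw [hσ, Units.neg_smul, one_smul]
    exact Submodule.neg_mem _ h

theorem mem_polyPiece_iff {m : ℤ} {p : Poly k n} :
    p ∈ polyPiece k n m ↔ ∀ β, coeff β p ≠ 0 → (β.degree : ℤ) = m := by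
  cases m with
  | ofNat m =>
    rw [polyPiece, mem_homogeneousSubmodule]
    refine ⟨fun h β hβ => ?_, fun h β hβ => ?_⟩
    · by_contra hne
      exact hβ (h.coeff_eq_zero fun h' => hne (by rw [h']; rfl))
    · have := h β hβ
      exact (DFunLike.congr_fun Finsupp.degree_eq_weight_one β).symm.trans (Int.ofNat_inj.1 this)
  | negSucc m =>
    rw [polyPiece, Submodule.mem_bot]
    refine ⟨fun h => by simp [h], fun h => ?_⟩
    ext β
    by_contra hne
    have := h β hne
    omega

theorem coeff_mem_polyPiece {m : ℕ} {p : DoublePoly k n} (hp : p ∈ totalPiece k n m)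
    (α : Fin (n + 1) →₀ ℕ) : coeff α p ∈ polyPiece k n (m - α.degree) := by
  rw [mem_polyPiece_iff]
  intro β hβ
  have := hp α β hβ
  omega

theorem mul_mem_polyPiece {a b : ℤ} {p q : Poly k n} (hp : p ∈ polyPiece k n a)
    (hq : q ∈ polyPiece k n b) : p * q ∈ polyPiece k n (a + b) := by
  classical
  rw [mem_polyPiece_iff] at *
  intro β h
  rw [coeff_mul] at h
  obtain ⟨⟨β₁, β₂⟩, hβ, h⟩ := Finset.exists_ne_zero_of_sum_ne_zero h
  have h1 := hp _ (left_ne_zero_of_mul h)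
  have h2 := hq _ (right_ne_zero_of_mul h)
  rw [Finset.HasAntidiagonal.mem_antidiagonal] at hβ
  simp only at h1 h2 hβ
  rw [← hβ, map_add]
  omega

end TotalDegree

/-! ### Functionals applied to the Bezoutian -/

section Functional

variable {k : Type*} [Field k] {n : ℕ}

theorem mixed_zero (p : Poly k n) : mixed 0 p = C p := by
  have h : aeval (fun i : Fin (n + 1) => if (i : ℕ) < 0 then yVar k i else xVar k i) =
      IsScalarTower.toAlgHom k (Poly k n) (DoublePoly k n) := by
    ext1 i
    simp [xVar, algebraMap_eq]
  exact DFunLike.congr_fun h p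

theorem mixed_last (p : Poly k n) : mixed (n + 1) p = map C p := by
  simp only [mixed, Fin.is_lt, if_true]
  induction p using MvPolynomial.induction_on with
  | C c => simp [algebraMap_eq, MvPolynomial.algebraMap_apply]
  | add p q hp hq => rw [map_add, map_add, hp, hq]
  | mul_X p i hp => rw [map_mul, map_mul, hp, aeval_X, map_X, yVar]

theorem sum_mul_dividedDiff (p : Poly k n) :
    ∑ j, (xVar k j - yVar k j) * dividedDiff j p = C p - map C p := by
  simp only [mul_dividedDiff]
  rw [Fin.sum_univ_eq_sum_range (fun j => mixed j p - mixed (j + 1) p) (n + 1),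
    Finset.sum_range_sub', mixed_zero, mixed_last]

/-- Multiplication by `x_j - y_j` sends the Bezoutian into the ideal of the differences
`f_i(x) - f_i(y)`. -/
theorem bezoutian_mul_mem (f : Fin (n + 1) → Poly k n) (j : Fin (n + 1)) :
    bezoutian f * (xVar k j - yVar k j) ∈
      Ideal.span (Set.range fun i => (C (f i) - map C (f i) : DoublePoly k n)) := by
  refine det_mul_mem_of_mulVec_mem (v := fun j => xVar k j - yVar k j) (fun i => ?_) j
  refine Ideal.subset_span ⟨i, ?_⟩
  refine (sum_mul_dividedDiff (f i)).symm.trans ?_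
  exact Finset.sum_congr rfl fun j _ => mul_comm _ _

theorem bezoutCoeff_zero_notMem {d : ℕ} {f : Fin (n + 1) → Poly k n}
    (hf : ∀ i, (f i).IsHomogeneous (d + 1)) (hf0 : NoCommonZeros f) :
    bezoutCoeff f 0 ∉ Ideal.span (Set.range f) := by
  obtain ⟨N, hN⟩ := exists_X_pow_mem hf0
  have hdet : bezoutCoeff f 0 =
      ((constantCoeff : DoublePoly k n →+* Poly k n).mapMatrix
        (Matrix.of fun i j => dividedDiff j (f i))).det :=
    (constantCoeff : DoublePoly k n →+* Poly k n).map_det _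
  rw [hdet]
  refine det_notMem_span_of_X_pow_mem (funext fun i => ?_) hN
  -- Setting `y = 0` in the telescoping identity gives `f = G x`, since `f_i(0) = 0` in positive
  -- degree.
  have h := congrArg (constantCoeff : DoublePoly k n →+* Poly k n) (sum_mul_dividedDiff (f i))
  have h0 : constantCoeff (f i) = 0 := (hf i).coeff_eq_zero (by simp)
  rw [map_sub, constantCoeff_C, constantCoeff_map, h0, map_zero, sub_zero, map_sum] at h
  rw [← h, Matrix.mulVec, dotProduct]
  refine Finset.sum_congr rfl fun j _ => ?_
  simp [xVar, yVar, mul_comm]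

/-- Apply a linear functional on `k[x]` to the coefficients of the `y^α` of an element of
`k[x, y]`. -/
noncomputable def mapCoeff (l : Module.Dual k (Poly k n)) : DoublePoly k n →ₗ[k] Poly k n where
  toFun Q := AddMonoidAlgebra.map l.toAddMonoidHom Q
  map_add' p q := by
    ext α
    simp
  map_smul' c p := by
    ext α
    simp [coeff_smul]

theorem coeff_mapCoeff (l : Module.Dual k (Poly k n)) (Q : DoublePoly k n)
    (α : Fin (n + 1) →₀ ℕ) : coeff α (mapCoeff l Q) = l (coeff α Q) :=
  rfl

theorem mapCoeff_map_mul (l : Module.Dual k (Poly k n)) (p : Poly k n) (Q : DoublePoly k n) :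
    mapCoeff l (map C p * Q) = p * mapCoeff l Q := by
  classical
  ext α
  rw [coeff_mapCoeff, coeff_mul, coeff_mul, map_sum]
  refine Finset.sum_congr rfl fun x _ => ?_
  rw [coeff_map, ← smul_eq_C_mul, map_smul, coeff_mapCoeff, smul_eq_mul]

theorem mapCoeff_C_mul_sub_mem {f : Fin (n + 1) → Poly k n} {l : Module.Dual k (Poly k n)}
    (hl : ∀ p ∈ Ideal.span (Set.range f), l p = 0) (p : Poly k n) :
    mapCoeff l (C p * bezoutian f) - p * mapCoeff l (bezoutian f) ∈
      Ideal.span (Set.range f) := by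
  have hmem : (C p - map C p) * bezoutian f ∈
      Ideal.span (Set.range fun i => (C (f i) - map C (f i) : DoublePoly k n)) := by
    rw [← sum_mul_dividedDiff, Finset.sum_mul]
    refine Ideal.sum_mem _ fun j _ => ?_
    have h := Ideal.mul_mem_left _ (dividedDiff j p) (bezoutian_mul_mem f j)
    convert h using 1
    ring
  rw [← mapCoeff_map_mul, ← map_sub, ← sub_mul]
  obtain ⟨c, hc⟩ := Ideal.mem_span_range_iff_exists_fun.1 hmem
  rw [← hc, map_sum]
  refine Ideal.sum_mem _ fun i _ => ?_
  have h0 : mapCoeff l (C (f i) * c i) = 0 := by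
    ext α
    rw [coeff_mapCoeff, coeff_C_mul, coeff_zero]
    exact hl _ (Ideal.mul_mem_right _ _ (Ideal.subset_span ⟨i, rfl⟩))
  rw [mul_comm, sub_mul, map_sub, h0, zero_sub, mapCoeff_map_mul]
  exact Ideal.neg_mem_iff _ |>.2 (Ideal.mul_mem_right _ _ (Ideal.subset_span ⟨i, rfl⟩))

attribute [local instance] MvPolynomial.gradedAlgebra

/-- A functional separating `p` from the ideal may be composed with the projection to degree `e`, as
the ideal is homogeneous. -/
theorem exists_graded_dual {d e : ℕ} {f : Fin (n + 1) → Poly k n}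
    (hf : ∀ i, (f i).IsHomogeneous d) {p : Poly k n} (hp : p.IsHomogeneous e)
    (hpI : p ∉ Ideal.span (Set.range f)) :
    ∃ l : Module.Dual k (Poly k n), (∀ q ∈ Ideal.span (Set.range f), l q = 0) ∧
      (∀ m : ℤ, m ≠ e → ∀ q ∈ polyPiece k n m, l q = 0) ∧ l p = 1 := by
  obtain ⟨l, hl, hlI⟩ := Submodule.exists_dual_map_eq_bot_of_notMem
    (p := (Ideal.span (Set.range f)).restrictScalars k) hpI inferInstance
  have hI : (Ideal.span (Set.range f)).IsHomogeneous (homogeneousSubmodule (Fin (n + 1)) k) := by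
    apply Ideal.homogeneous_span
    rintro _ ⟨i, rfl⟩
    exact ⟨d, hf i⟩
  refine ⟨(l p)⁻¹ • l.comp (homogeneousComponent e), fun q hq => ?_, fun m hm q hq => ?_, ?_⟩
  · have h : l (homogeneousComponent e q) ∈
        ((Ideal.span (Set.range f)).restrictScalars k).map l :=
      Submodule.mem_map_of_mem (homogeneousComponent_mem_of_mem hI hq e)
    rw [hlI, Submodule.mem_bot] at h
    simp [h]
  · have h : homogeneousComponent e q = 0 := by
      ext β
      rw [coeff_homogeneousComponent, coeff_zero]
      split_ifs with hβ
      · by_contra hne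
        exact hm (by rw [← mem_polyPiece_iff.1 hq β hne, hβ])
      · rfl
    simp [h]
  · simp [homogeneousComponent_eq_self hp, hl]

theorem exists_dual_quotient (I : Ideal (Poly k n)) {l : Module.Dual k (Poly k n)}
    (hl : ∀ q ∈ I, l q = 0) :
    ∃ φ : Module.Dual k (Poly k n ⧸ I), ∀ q, φ (Ideal.Quotient.mk I q) = l q :=
  ⟨((I.restrictScalars k).liftQ l fun q hq => hl q hq).comp
    (Submodule.Quotient.restrictScalarsEquiv k I).symm.toLinearMap, fun _ => rfl⟩

end Functional

/-! ### The duality map and its bijectivity -/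

section Duality

variable {k : Type*} [Field k] {n : ℕ}

theorem monomial_mem_polyPiece {a : ℤ} {α : Fin (n + 1) →₀ ℕ} (hα : α ∈ exponents n a) :
    monomial α (1 : k) ∈ polyPiece k n a := by
  classical
  refine mem_polyPiece_iff.2 fun β hβ => ?_
  rw [coeff_monomial] at hβ
  split_ifs at hβ with h
  · rw [← h]
    exact mem_exponents.1 hα
  · exact absurd rfl hβ

/-- The map `φ ↦ ∑ φ([Δ_α]) [x^α]`, the sum over `|α| = a`. -/
noncomputable def bezoutMap (f : Fin (n + 1) → Poly k n) (I : Ideal (Poly k n)) {a b : ℤ}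
    (hΔ : ∀ α ∈ exponents n a, bezoutCoeff f α ∈ polyPiece k n b) :
    Module.Dual k (quotPiece I b) →ₗ[k] quotPiece I a where
  toFun φ := ∑ α ∈ (exponents n a).attach,
    φ ⟨Ideal.Quotient.mk I (bezoutCoeff f α.1), mk_mem_quotPiece I (hΔ α.1 α.2)⟩ •
      ⟨Ideal.Quotient.mk I (monomial α.1 (1 : k)), mk_mem_quotPiece I (monomial_mem_polyPiece α.2)⟩
  map_add' φ ψ := by simp only [LinearMap.add_apply, add_smul, Finset.sum_add_distrib]
  map_smul' c φ := by
    simp only [LinearMap.smul_apply, smul_assoc, Finset.smul_sum, RingHom.id_apply]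

theorem coe_bezoutMap (f : Fin (n + 1) → Poly k n) (I : Ideal (Poly k n)) {a b : ℤ}
    (hΔ : ∀ α ∈ exponents n a, bezoutCoeff f α ∈ polyPiece k n b)
    (φ : Module.Dual k (quotPiece I b)) :
    (bezoutMap f I hΔ φ : Poly k n ⧸ I) = ∑ α ∈ (exponents n a).attach,
      φ ⟨Ideal.Quotient.mk I (bezoutCoeff f α.1), mk_mem_quotPiece I (hΔ α.1 α.2)⟩ •
        Ideal.Quotient.mk I (monomial α.1 (1 : k)) := by
  simp [bezoutMap]

theorem bezoutCoeff_mem_polyPiece {d : ℕ} {f : Fin (n + 1) → Poly k n}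
    (hf : ∀ i, (f i).IsHomogeneous (d + 1)) (α : Fin (n + 1) →₀ ℕ) :
    bezoutCoeff f α ∈ polyPiece k n (((n + 1) * d : ℕ) - α.degree) :=
  coeff_mem_polyPiece (bezoutian_mem_totalPiece hf) α

theorem bezoutMap_surjective {d : ℕ} {f : Fin (n + 1) → Poly k n}
    (hf : ∀ i, (f i).IsHomogeneous (d + 1)) (hf0 : NoCommonZeros f) {a b : ℤ}
    (hab : a + b = ((n + 1) * d : ℕ))
    (hΔ : ∀ α ∈ exponents n a, bezoutCoeff f α ∈ polyPiece k n b) :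
    Function.Surjective (bezoutMap f (Ideal.span (Set.range f)) hΔ) := by
  classical
  set I := Ideal.span (Set.range f) with hI
  have hzero : bezoutCoeff f 0 ∈ polyPiece k n (((n + 1) * d : ℕ) : ℤ) := by
    simpa using bezoutCoeff_mem_polyPiece hf 0
  obtain ⟨l, hlI, hl, hl1⟩ := exists_graded_dual hf hzero (bezoutCoeff_zero_notMem hf hf0)
  have hone : mapCoeff l (bezoutian f) = 1 := by
    ext α
    rw [coeff_mapCoeff, coeff_one]
    split_ifs with hα
    · rw [← hα]
      exact hl1
    · refine hl _ (fun h => hα ?_) _ (bezoutCoeff_mem_polyPiece hf α)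
      have : α.degree = 0 := by omega
      exact ((Finsupp.degree_eq_zero_iff α).1 this).symm
  rintro ⟨_, p, hp, rfl⟩
  obtain ⟨φ, hφ⟩ := exists_dual_quotient I (l := l.comp (LinearMap.mulLeft k p))
    fun q hq => hlI _ (Ideal.mul_mem_left _ _ hq)
  -- Terms with `|α| ≠ a` vanish, because `p * Δ_α` then has degree different from `ρ`.
  have hsum : ∑ α ∈ exponents n a, l (p * bezoutCoeff f α) • monomial α (1 : k) =
      mapCoeff l (C p * bezoutian f) := by
    ext α
    rw [coeff_sum, coeff_mapCoeff, coeff_C_mul]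
    simp only [coeff_smul, coeff_monomial, smul_eq_mul, mul_ite, mul_one, mul_zero,
      Finset.sum_ite_eq']
    split_ifs with hα
    · rfl
    · refine (hl _ (fun h => hα ?_) _
        (mul_mem_polyPiece hp (bezoutCoeff_mem_polyPiece hf α))).symm
      rw [mem_exponents]
      omega
  refine ⟨φ.comp (quotPiece I b).subtype, Subtype.ext ?_⟩
  rw [coe_bezoutMap]
  have hmk : Ideal.Quotient.mk I (mapCoeff l (C p * bezoutian f)) = Ideal.Quotient.mk I p := by
    have h := mapCoeff_C_mul_sub_mem hlI p
    rw [hone, mul_one] at h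
    exact Ideal.Quotient.eq.2 h
  refine Eq.trans ?_ hmk
  rw [← hsum, map_sum, ← Finset.sum_attach (exponents n a)]
  refine Finset.sum_congr rfl fun α _ => ?_
  rw [LinearMap.comp_apply, Submodule.subtype_apply, hφ]
  rfl

instance quotPiece_finite (I : Ideal (Poly k n)) (a : ℤ) :
    Module.Finite k (quotPiece I a) := by
  rw [Module.Finite.iff_fg, quotPiece]
  refine Submodule.FG.map _ ?_
  cases a with
  | ofNat a => exact homogeneousSubmodule_fg _ _ a
  | negSucc a => exact Submodule.fg_bot

theorem bezoutMap_bijective {d : ℕ} {f : Fin (n + 1) → Poly k n}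
    (hf : ∀ i, (f i).IsHomogeneous (d + 1)) (hf0 : NoCommonZeros f) {a b : ℤ}
    (hab : a + b = ((n + 1) * d : ℕ))
    (hΔ : ∀ α ∈ exponents n a, bezoutCoeff f α ∈ polyPiece k n b) :
    Function.Bijective (bezoutMap f (Ideal.span (Set.range f)) hΔ) := by
  have hΔ' : ∀ α ∈ exponents n b, bezoutCoeff f α ∈ polyPiece k n a := by
    intro α hα
    rw [mem_exponents] at hα
    convert bezoutCoeff_mem_polyPiece hf α
    omega
  have hs := bezoutMap_surjective hf hf0 hab hΔ
  have h1 := LinearMap.finrank_le_finrank_of_surjective hs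
  -- Exchanging `a` and `b` gives the reverse inequality of dimensions.
  have h2 := LinearMap.finrank_le_finrank_of_surjective
    (bezoutMap_surjective hf hf0 (by omega) hΔ')
  rw [Subspace.dual_finrank_eq] at h1 h2
  refine ⟨(LinearMap.injective_iff_surjective_of_finrank_eq_finrank ?_).2 hs, hs⟩
  rw [Subspace.dual_finrank_eq]
  exact le_antisymm h2 h1

end Duality

end BezoutDuality

theorem mainTheorem2 {k : Type*} [Field k] (n d : ℕ) (hd : 1 ≤ d)
    (f : Fin (n + 1) → BezoutDuality.Poly k n) (hf : ∀ i, (f i).IsHomogeneous d)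
    (hf0 : BezoutDuality.NoCommonZeros f)
    (I : Ideal (BezoutDuality.Poly k n)) (hI : I = Ideal.span (Set.range f))
    (ρ : ℤ) (hρ : ρ = ((n : ℤ) + 1) * ((d : ℤ) - 1)) (a : ℤ) :
    ∃ hΔ : ∀ α ∈ BezoutDuality.exponents n a,
        BezoutDuality.bezoutCoeff f α ∈ BezoutDuality.polyPiece k n (ρ - a),
      ∃ e : Module.Dual k (BezoutDuality.quotPiece I (ρ - a)) ≃ₗ[k]
          BezoutDuality.quotPiece I a,
        ∀ φ : Module.Dual k (BezoutDuality.quotPiece I (ρ - a)),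
          (e φ : BezoutDuality.Poly k n ⧸ I) =
            ∑ α ∈ (BezoutDuality.exponents n a).attach,
              φ ⟨Ideal.Quotient.mk I (BezoutDuality.bezoutCoeff f α.1),
                  BezoutDuality.mk_mem_quotPiece I (hΔ α.1 α.2)⟩ •
                Ideal.Quotient.mk I (MvPolynomial.monomial α.1 (1 : k)) := by
  -- With `d + 1` for the degree, divided differences have degree `d` and `ρ = (n + 1) * d` is a
  -- natural number.
  obtain ⟨d, rfl⟩ := Nat.exists_eq_add_of_le' hd
  have hρ' : ρ = ((n + 1) * d : ℕ) := by
    rw [hρ]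
    push_cast
    ring
  subst hI
  have hΔ : ∀ α ∈ BezoutDuality.exponents n a,
      BezoutDuality.bezoutCoeff f α ∈ BezoutDuality.polyPiece k n (ρ - a) := by
    intro α hα
    rw [← BezoutDuality.mem_exponents.1 hα, hρ']
    exact BezoutDuality.bezoutCoeff_mem_polyPiece hf α
  exact ⟨hΔ, LinearEquiv.ofBijective (BezoutDuality.bezoutMap f _ hΔ)
    (BezoutDuality.bezoutMap_bijective hf hf0 (by rw [← hρ']; ring) hΔ),
    BezoutDuality.coe_bezoutMap f _ hΔ⟩
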